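/- Let $t_0\in\mathbb R$, let $a_1,\dots,a_n:[t_0,\infty)\to\mathbb R$ be Lebesgue measurable and essentially bounded, and let $h_1,\dots,h_n:[t_0,\infty)\to\mathbb R$ be Lebesgue measurable with $0\le t-h_j(t)\le\tau_j$ for almost every $t\ge t_0$, where $\tau_1,\dots,\tau_n$ are constants. Write $\|f\|=\operatorname{ess\,sup}_{t\ge t_0}|f(t)|$ and $A(t)=\sum_{j=1}^n a_j(t)$. Assume that there is a constant $\alpha>0$ with $A(t)\ge\alpha$ for almost every $t\ge t_0$, and that either (i) $\displaystyle\sum_{j=1}^n\tau_j\|a_j\|<1$ and $\displaystyle\Big(\sum_{j=1}^n\|a_j\|\Big)\Big(\sum_{j=1}^n\tau_j\Big\|\frac{a_j}{A}\Big\|\Big)<1$, or (ii) $\displaystyle\|A\|\sum_{j=1}^n\tau_j\Big\|\frac{a_j}{A}\Big\|<1-\sum_{j=1}^n\tau_j\|a_j\|$. Then the equation $$\dot x(t)+\sum_{j=1}^n a_j(t)\,x(h_j(t))=0$$ is uniformly exponentially stable on $[t_0,\infty)$: there are constants $M>0$ and $\nu>0$ such that for every initial point $s\ge t_0$, every bounded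 Borel measurable initial function $\psi:(-\infty,s]\to\mathbb R$, and every solution $x$ of the initial value problem (that is, $x=\psi$ on $(-\infty,s]$, $x$ is locally absolutely continuous on $[s,\infty)$ and satisfies the equation for almost every $t\ge s$), $$|x(t)|\le M e^{-\nu(t-s)}\sup_{u\le s}|\psi(u)|\qquad\text{for all }t\ge s.$$ -/

import Mathlib

open MeasureTheory Set
open scoped ENNReal

noncomputable section

/-- Lebesgue measure on the half-line `[t₀, ∞)`. -/
def halfLine (t₀ : ℝ) : Measure ℝ := volume.restrict (Ici t₀)

/-- The norm `‖f‖ = ess sup_{t ≥ t₀} |f t|` of `L_∞[t₀, ∞)`, as a real number.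
It is meaningful for essentially bounded measurable `f`, that is, `MemLp f ∞ (halfLine t₀)`. -/
def essNorm (t₀ : ℝ) (f : ℝ → ℝ) : ℝ := (eLpNorm f ∞ (halfLine t₀)).toReal

/-- The sum of the coefficients, `A t = ∑ j, a j t`. -/
def coeffSum {n : ℕ} (a : Fin n → ℝ → ℝ) (t : ℝ) : ℝ := ∑ j, a j t

/-- `x` solves the initial value problem
`x'(t) + ∑ j, a j t * x (h j t) = 0` for `t ≥ s`, `x t = ψ t` for `t ≤ s`:
it is locally absolutely continuous on `[s, ∞)`, satisfies the equation almost everywhere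
there, and coincides with the initial function on `(-∞, s]`. -/
structure IsSolution {n : ℕ} (a h : Fin n → ℝ → ℝ) (s : ℝ) (ψ : Iic s → ℝ) (x : ℝ → ℝ) :
    Prop where
  initial : ∀ t : Iic s, x t = ψ t
  absCont : ∀ T : ℝ, s ≤ T → AbsolutelyContinuousOnInterval x s T
  equation : ∀ᵐ t ∂(halfLine s), HasDerivAt x (-∑ j, a j t * x (h j t)) t

/-- Uniform exponential stability of `x'(t) + ∑ j, a j t * x (h j t) = 0` on `[t₀, ∞)`:
one exponential estimate, with constants `M` and `ν`, holds for every initial point `s ≥ t₀`,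
every bounded Borel measurable initial function `ψ` on `(-∞, s]` and every solution. -/
def UniformlyExponentiallyStable {n : ℕ} (t₀ : ℝ) (a h : Fin n → ℝ → ℝ) : Prop :=
  ∃ M ν : ℝ, 0 < M ∧ 0 < ν ∧
    ∀ s : ℝ, t₀ ≤ s → ∀ ψ : Iic s → ℝ, Measurable ψ → BddAbove (range fun u => |ψ u|) →
      ∀ x : ℝ → ℝ, IsSolution a h s ψ x →
        ∀ t : ℝ, s ≤ t → |x t| ≤ M * Real.exp (-ν * (t - s)) * ⨆ u : Iic s, |ψ u|

end

/-!
The equation is read as a perturbation of the scalar equation `x' + A x = 0`, `A = ∑ j, a j`: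
`x' + A x = ∑ j, a j * (x - x (h j))`, where each difference is at most `τ j` times a bound on
`x'` over the delay interval. Everything is measured with the weight `exp (ν (t - s))`, which a
delay of at most `r` distorts by no more than a factor `exp (ν r)`.

Let `X` be the maximum of the weighted solution on a compact interval and `c` its least essential
bound for the weighted derivative. Since `A ≥ α > ν`, a barrier argument for absolutely continuous
functions gives `X ≤ α / (α - ν) * (∑ j, τ j * ‖a j / A‖) * exp (ν r) * c`, up to the contribution
of the initial function (`IsSolution.weighted_abs_le`). Conversely the equation bounds `c` by `X`:
directly, `c ≤ (∑ j, ‖a j‖) * exp (ν r) * X`, or in perturbed form,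
`c ≤ ‖A‖ * X + (∑ j, τ j * ‖a j‖) * exp (ν r) * c`. At `ν = 0` the two products of gains are less
than one by the two alternative hypotheses, and by continuity they stay so for some `ν > 0`
(`exists_small_gain_rate`). Hence `X` is bounded by a multiple of the supremum of the initial
function, uniformly in the interval and in the initial point
(`IsSolution.weighted_abs_le_of_small_gain`), which is the exponential estimate. On the interval
`[s, s + r]`, where the delayed argument may fall before `s`, a Gronwall type bound is used instead
(`IsSolution.abs_le_exp`).
-/

/-! ### Absolutely continuous functions -/

/-- Mean value inequality for absolutely continuous functions, with a smooth majorant of the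
almost everywhere derivative. -/
lemma AbsolutelyContinuousOnInterval.abs_sub_le_of_ae_abs_deriv_le {f φ φ' : ℝ → ℝ} {a b : ℝ}
    (hf : AbsolutelyContinuousOnInterval f a b) (hab : a ≤ b)
    (hφ : ∀ u, HasDerivAt φ (φ' u) u) (hφ' : Continuous φ')
    (h : ∀ᵐ u, a ≤ u → u ≤ b → |deriv f u| ≤ φ' u) :
    |f b - f a| ≤ φ b - φ a := by
  rw [← hf.integral_deriv_eq_sub,
    ← intervalIntegral.integral_eq_sub_of_hasDerivAt (fun u _ => hφ u)
      (hφ'.intervalIntegrable a b)]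
  rw [← Real.norm_eq_abs]
  refine intervalIntegral.norm_integral_le_of_norm_le (μ := volume) hab ?_
    (hφ'.intervalIntegrable a b)
  filter_upwards [h] with u hu hu'
  exact hu hu'.1.le hu'.2

/-- Barrier principle: an absolutely continuous function whose derivative is nonpositive wherever
it lies above the level `M` cannot cross that level upwards. -/
lemma AbsolutelyContinuousOnInterval.le_of_ae_deriv_nonpos_above {f : ℝ → ℝ} {a b M : ℝ}
    (hf : AbsolutelyContinuousOnInterval f a b) (hab : a ≤ b) (ha : f a ≤ M)
    (h : ∀ᵐ u, a ≤ u → u ≤ b → M < f u → deriv f u ≤ 0) : f b ≤ M := by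
  by_contra! hb
  -- `c` is the last time at which `f ≤ M`; after it `f` is antitone.
  have hcont : ContinuousOn f (Icc a b) := by
    simpa [uIcc_of_le hab] using hf.continuousOn
  have hcpt : IsCompact (Icc a b ∩ f ⁻¹' Iic M) :=
    isCompact_Icc.of_isClosed_subset
      (hcont.preimage_isClosed_of_isClosed isClosed_Icc isClosed_Iic) inter_subset_left
  obtain ⟨c, ⟨⟨hac, hcb⟩, hcM⟩, hmax⟩ := hcpt.exists_isGreatest ⟨a, ⟨le_rfl, hab⟩, ha⟩
  have hcM' : f c ≤ M := hcM
  have hsub : AbsolutelyContinuousOnInterval f c b :=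
    hf.mono (by rw [uIcc_of_le hab, uIcc_of_le hcb]; exact Icc_subset_Icc_left hac)
  have hint : ∫ u in c..b, deriv f u ≤ ∫ u in c..b, (0 : ℝ) := by
    rw [intervalIntegral.integral_of_le hcb, intervalIntegral.integral_of_le hcb]
    refine setIntegral_mono_ae_restrict ?_ (by simp) ?_
    · exact (intervalIntegrable_iff_integrableOn_Ioc_of_le hcb).1 hsub.intervalIntegrable_deriv
    · refine (ae_restrict_iff' measurableSet_Ioc).2 ?_
      filter_upwards [h] with u hu hcu
      refine hu (hac.trans hcu.1.le) hcu.2 ?_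
      by_contra! hle
      exact absurd (hmax ⟨⟨hac.trans hcu.1.le, hcu.2⟩, hle⟩) (not_le.2 hcu.1)
  rw [hsub.integral_deriv_eq_sub] at hint
  simp only [intervalIntegral.integral_zero] at hint
  linarith

/-! ### Essential bounds -/

lemma MeasureTheory.MemLp.ae_abs_le_essNorm {t₀ : ℝ} {f : ℝ → ℝ} (hf : MemLp f ∞ (halfLine t₀)) :
    ∀ᵐ t ∂(halfLine t₀), |f t| ≤ essNorm t₀ f := by
  have hfin : eLpNormEssSup f (halfLine t₀) ≠ ∞ := by
    simpa [eLpNorm_exponent_top] using hf.2.ne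
  filter_upwards [ae_le_eLpNormEssSup (f := f) (μ := halfLine t₀)] with t ht
  have := ENNReal.toReal_mono hfin ht
  simpa [essNorm, eLpNorm_exponent_top] using this

/-- A least essential bound: if an essentially bounded function has, for every `c ≥ 0` that is an
almost everywhere bound, the better bound `max p (q + σ * c)`, then some bound `c` satisfies
`c ≤ max p (q + σ * c)`. -/
lemma exists_ae_bound_le_of_improvement {μ : Measure ℝ} {f : ℝ → ℝ} {c₀ p q σ : ℝ}
    (hp : 0 ≤ p) (h₀ : ∀ᵐ t ∂μ, |f t| ≤ c₀)
    (himp : ∀ c, 0 ≤ c → (∀ᵐ t ∂μ, |f t| ≤ c) → ∀ᵐ t ∂μ, |f t| ≤ max p (q + σ * c)) :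
    ∃ c, 0 ≤ c ∧ (∀ᵐ t ∂μ, |f t| ≤ c) ∧ c ≤ max p (q + σ * c) := by
  have hfin : eLpNormEssSup f μ ≠ ∞ := (eLpNormEssSup_lt_top_of_ae_bound h₀).ne
  have hae : ∀ᵐ t ∂μ, |f t| ≤ (eLpNormEssSup f μ).toReal := by
    filter_upwards [ae_le_eLpNormEssSup (f := f) (μ := μ)] with t ht
    simpa using ENNReal.toReal_mono hfin ht
  refine ⟨_, ENNReal.toReal_nonneg, hae, ?_⟩
  exact ENNReal.toReal_le_of_le_ofReal (hp.trans (le_max_left _ _))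
    (eLpNormEssSup_le_of_ae_bound (himp _ ENNReal.toReal_nonneg hae))

/-! ### Pointwise estimates along a solution -/

/-- Almost everywhere bounds for the equation `x' + ∑ j, a j * x (h j) = 0` from time `s` on:
delays at most `τ j ≤ r`, coefficients bounded by `N j` and, relative to their sum `A`, by `R j`,
and `α ≤ A ≤ Amax`. -/
structure CoefficientBounds {n : ℕ} (a h : Fin n → ℝ → ℝ) (τ N R : Fin n → ℝ)
    (α Amax r s : ℝ) : Prop where
  r_nonneg : 0 ≤ r
  τ_nonneg : ∀ j, 0 ≤ τ j
  τ_le : ∀ j, τ j ≤ r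
  N_nonneg : ∀ j, 0 ≤ N j
  R_nonneg : ∀ j, 0 ≤ R j
  delay : ∀ᵐ t, s ≤ t → ∀ j, t - τ j ≤ h j t ∧ h j t ≤ t
  abs_le : ∀ᵐ t, s ≤ t → ∀ j, |a j t| ≤ N j
  abs_le_mul : ∀ᵐ t, s ≤ t → ∀ j, |a j t| ≤ R j * coeffSum a t
  sum_mem : ∀ᵐ t, s ≤ t → α ≤ coeffSum a t ∧ coeffSum a t ≤ Amax

section Estimates

variable {n : ℕ} {a h : Fin n → ℝ → ℝ} {τ N R : Fin n → ℝ} {α Amax r s : ℝ}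
  {ψ : Iic s → ℝ} {x : ℝ → ℝ}

lemma IsSolution.ae_hasDerivAt (hx : IsSolution a h s ψ x) :
    ∀ᵐ t, s ≤ t → HasDerivAt x (-∑ j, a j t * x (h j t)) t :=
  (ae_restrict_iff' measurableSet_Ici).1 hx.equation

lemma IsSolution.absCont_of_le (hx : IsSolution a h s ψ x) {b c : ℝ} (hb : s ≤ b) (hbc : b ≤ c) :
    AbsolutelyContinuousOnInterval x b c :=
  (hx.absCont c (hb.trans hbc)).mono
    (by rw [uIcc_of_le hbc, uIcc_of_le (hb.trans hbc)]; exact Icc_subset_Icc_left hb)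

lemma IsSolution.continuousOn_Icc (hx : IsSolution a h s ψ x) (T : ℝ) :
    ContinuousOn x (Icc s T) := by
  rcases le_or_gt s T with hT | hT
  · simpa [uIcc_of_le hT] using (hx.absCont T hT).continuousOn
  · simp [Icc_eq_empty hT.not_ge]

lemma IsSolution.ae_abs_deriv_le (hx : IsSolution a h s ψ x)
    (hb : CoefficientBounds a h τ N R α Amax r s) :
    ∀ᵐ t, s ≤ t → ∀ B, (∀ v, t - r ≤ v → v ≤ t → |x v| ≤ B) → |deriv x t| ≤ (∑ j, N j) * B := by
  filter_upwards [hx.ae_hasDerivAt, hb.delay, hb.abs_le] with t hd hdel hN hst B hB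
  rw [(hd hst).deriv, abs_neg, Finset.sum_mul]
  refine (Finset.abs_sum_le_sum_abs _ _).trans (Finset.sum_le_sum fun j _ => ?_)
  rw [abs_mul]
  obtain ⟨h1, h2⟩ := hdel hst j
  exact mul_le_mul (hN hst j) (hB _ (by linarith [hb.τ_le j]) h2) (abs_nonneg _) (hb.N_nonneg j)

/-- The equation as a perturbation of `x' + A x = 0`: the perturbation is
`∑ j, a j * (x - x (h j))`. -/
lemma IsSolution.ae_abs_deriv_add_le (hx : IsSolution a h s ψ x)
    (hb : CoefficientBounds a h τ N R α Amax r s) :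
    ∀ᵐ t, s ≤ t → ∀ D, 0 ≤ D → (∀ v, t - r ≤ v → v ≤ t → |x t - x v| ≤ (t - v) * D) →
      |deriv x t + coeffSum a t * x t| ≤ (∑ j, τ j * N j) * D ∧
      |deriv x t + coeffSum a t * x t| ≤ coeffSum a t * ((∑ j, τ j * R j) * D) := by
  filter_upwards [hx.ae_hasDerivAt, hb.delay, hb.abs_le, hb.abs_le_mul]
    with t hd hdel hN hR hst D hD0 hD
  have key : |deriv x t + coeffSum a t * x t| ≤ ∑ j, |a j t| * (τ j * D) := by
    have : deriv x t + coeffSum a t * x t = ∑ j, a j t * (x t - x (h j t)) := by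
      rw [(hd hst).deriv, coeffSum]
      simp only [mul_sub, Finset.sum_sub_distrib, Finset.sum_mul]
      ring
    rw [this]
    refine (Finset.abs_sum_le_sum_abs _ _).trans (Finset.sum_le_sum fun j _ => ?_)
    rw [abs_mul]
    obtain ⟨h1, h2⟩ := hdel hst j
    refine mul_le_mul_of_nonneg_left ?_ (abs_nonneg _)
    refine (hD _ (by linarith [hb.τ_le j]) h2).trans ?_
    exact mul_le_mul_of_nonneg_right (by linarith) hD0
  refine ⟨key.trans ?_, key.trans ?_⟩
  · rw [Finset.sum_mul]
    refine Finset.sum_le_sum fun j _ => ?_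
    calc |a j t| * (τ j * D) ≤ N j * (τ j * D) :=
          mul_le_mul_of_nonneg_right (hN hst j) (mul_nonneg (hb.τ_nonneg j) hD0)
      _ = _ := by ring
  · rw [Finset.sum_mul, Finset.mul_sum]
    refine Finset.sum_le_sum fun j _ => ?_
    calc |a j t| * (τ j * D) ≤ R j * coeffSum a t * (τ j * D) :=
          mul_le_mul_of_nonneg_right (hR hst j) (mul_nonneg (hb.τ_nonneg j) hD0)
      _ = _ := by ring

/-- A priori growth bound, used only on the time interval `[s, s + r]` on which the equation still
sees the initial function. -/
lemma IsSolution.abs_le_exp (hx : IsSolution a h s ψ x)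
    (hb : CoefficientBounds a h τ N R α Amax r s) {K : ℝ} (hK : ∀ u ≤ s, |x u| ≤ K)
    {t : ℝ} (hst : s ≤ t) :
    |x t| ≤ 2 * K * Real.exp (2 * (∑ j, N j) * (t - s)) := by
  set l := ∑ j, N j with hl
  have hl0 : 0 ≤ l := Finset.sum_nonneg fun j _ => hb.N_nonneg j
  have hK0 : 0 ≤ K := (abs_nonneg _).trans (hK s le_rfl)
  -- Maximize `|x|` relative to the exponential weight.
  set g : ℝ → ℝ := fun u => Real.exp (2 * l * (u - s)) with hg
  have hg0 : ∀ u, 0 < g u := fun u => Real.exp_pos _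
  have hg1 : ∀ u, s ≤ u → 1 ≤ g u := fun u hu =>
    Real.one_le_exp (mul_nonneg (by positivity) (sub_nonneg.2 hu))
  have hgmono : ∀ u v, u ≤ v → g u ≤ g v := fun u v huv => by
    simp only [hg]; gcongr
  have hgs : g s = 1 := by simp [hg]
  have hgc : Continuous g := by fun_prop
  obtain ⟨p, ⟨hsp, hpt⟩, hmax⟩ := isCompact_Icc.exists_isMaxOn (nonempty_Icc.2 hst)
    (((hx.continuousOn_Icc t).abs).div hgc.continuousOn fun u _ => (hg0 u).ne')
  set Z := |x p| / g p with hZ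
  have hZle : ∀ v, s ≤ v → v ≤ t → |x v| ≤ Z * g v := fun v h1 h2 =>
    (div_le_iff₀ (hg0 v)).1 (hmax ⟨h1, h2⟩)
  set m := max K Z with hm
  have hm0 : 0 ≤ m := hK0.trans (le_max_left _ _)
  have hhist : ∀ u, s ≤ u → u ≤ t → ∀ v ≤ u, |x v| ≤ m * g u := by
    intro u h1 h2 v hv
    rcases le_total s v with hsv | hvs
    · calc |x v| ≤ Z * g v := hZle v hsv (hv.trans h2)
        _ ≤ m * g v := mul_le_mul_of_nonneg_right (le_max_right _ _) (hg0 v).le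
        _ ≤ m * g u := mul_le_mul_of_nonneg_left (hgmono _ _ hv) hm0
    · calc |x v| ≤ K := hK v hvs
        _ ≤ m := le_max_left _ _
        _ ≤ m * g u := le_mul_of_one_le_right hm0 (hg1 u h1)
  have hinc : |x p - x s| ≤ m / 2 * g p - m / 2 * g s := by
    refine (hx.absCont p hsp).abs_sub_le_of_ae_abs_deriv_le hsp (φ := fun u => m / 2 * g u)
      (φ' := fun u => l * (m * g u)) ?_ (by fun_prop) ?_
    · intro u
      have h1 : HasDerivAt (fun u : ℝ => 2 * l * (u - s)) (2 * l * 1) u :=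
        ((hasDerivAt_id u).sub_const s).const_mul (2 * l)
      have h2 := h1.exp.const_mul (m / 2)
      exact h2.congr_deriv (by simp only [hg]; ring)
    · filter_upwards [hx.ae_abs_deriv_le hb] with u hu h1 h2
      exact hu h1 _ fun v _ hv => hhist u h1 (h2.trans hpt) v hv
  have hZK : Z ≤ 2 * K := by
    have h1 : |x p| ≤ K + |x p - x s| := by
      have := abs_add_le (x s) (x p - x s)
      rw [add_sub_cancel] at this
      linarith [hK s le_rfl]
    rw [hgs] at hinc
    have h2 : Z * g p = |x p| := div_mul_cancel₀ _ (hg0 p).ne'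
    rcases le_total K Z with hKZ | hZK
    · have hmZ : m = Z := max_eq_right hKZ
      rw [hmZ] at hinc
      have hZ0 : 0 ≤ Z := hK0.trans hKZ
      have h3 := mul_le_mul_of_nonneg_left (hg1 p hsp) hZ0
      nlinarith
    · linarith
  calc |x t| ≤ Z * g t := hZle t hst le_rfl
    _ ≤ 2 * K * g t := mul_le_mul_of_nonneg_right hZK (hg0 t).le

/-! ### Exponentially weighted estimates -/

/-- A weighted bound on the derivative bounds the increments of the solution over a delay. -/
lemma IsSolution.abs_sub_le_of_ae_weighted_deriv_le (hx : IsSolution a h s ψ x) {ν c T : ℝ}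
    (hν : 0 ≤ ν) (hP : ∀ᵐ t, s ≤ t → t ≤ T → Real.exp (ν * (t - s)) * |deriv x t| ≤ c)
    {t v : ℝ} (htT : t ≤ T) (hsv : s ≤ v) (hrv : t - r ≤ v) (hvt : v ≤ t) :
    |x t - x v| ≤ (t - v) * (Real.exp (ν * r) * c / Real.exp (ν * (t - s))) := by
  set D := Real.exp (ν * r) * c / Real.exp (ν * (t - s)) with hD
  have := (hx.absCont_of_le hsv hvt).abs_sub_le_of_ae_abs_deriv_le hvt (φ := fun u => u * D)
    (φ' := fun _ => D) (fun u => by simpa using (hasDerivAt_id u).mul_const D)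
    continuous_const ?_
  · calc _ ≤ _ := this
      _ = _ := by ring
  · filter_upwards [hP] with u hu hvu hut
    have h1 := hu (hsv.trans hvu) (hut.trans htT)
    have h2 : Real.exp (ν * (t - s)) ≤ Real.exp (ν * r) * Real.exp (ν * (u - s)) := by
      rw [← Real.exp_add]
      refine Real.exp_le_exp.2 ?_
      nlinarith
    rw [hD, le_div_iff₀ (Real.exp_pos _)]
    calc |deriv x u| * Real.exp (ν * (t - s))
        ≤ |deriv x u| * (Real.exp (ν * r) * Real.exp (ν * (u - s))) := by gcongr
      _ = Real.exp (ν * r) * (Real.exp (ν * (u - s)) * |deriv x u|) := by ring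
      _ ≤ _ := by gcongr

lemma IsSolution.ae_weighted_perturbation_le (hx : IsSolution a h s ψ x)
    (hb : CoefficientBounds a h τ N R α Amax r s) {ν c T : ℝ} (hν : 0 ≤ ν) (hc : 0 ≤ c)
    (hP : ∀ᵐ t, s ≤ t → t ≤ T → Real.exp (ν * (t - s)) * |deriv x t| ≤ c) :
    ∀ᵐ t, s + r ≤ t → t ≤ T →
      Real.exp (ν * (t - s)) * |deriv x t + coeffSum a t * x t|
        ≤ (∑ j, τ j * N j) * (Real.exp (ν * r) * c) ∧
      Real.exp (ν * (t - s)) * |deriv x t + coeffSum a t * x t|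
        ≤ coeffSum a t * ((∑ j, τ j * R j) * (Real.exp (ν * r) * c)) := by
  filter_upwards [hx.ae_abs_deriv_add_le hb] with t ht hst htT
  obtain ⟨h1, h2⟩ := ht (by linarith [hb.r_nonneg]) _ (by positivity) fun v hrv hvt =>
    hx.abs_sub_le_of_ae_weighted_deriv_le (r := r) hν hP htT (by linarith) hrv hvt
  have hw := Real.exp_pos (ν * (t - s))
  constructor
  · calc _ ≤ _ := mul_le_mul_of_nonneg_left h1 hw.le
      _ = _ := by field_simp
  · calc _ ≤ _ := mul_le_mul_of_nonneg_left h2 hw.le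
      _ = _ := by field_simp

/-- Weighted bound on the solution from a weighted bound on its derivative: the weighted solution
`y` satisfies `y' + (A - ν) y = g` with `|g| ≤ A * (∑ j, τ j * R j) * exp (ν r) * c`, and the
barrier principle applies because `A ≤ α / (α - ν) * (A - ν)`. -/
lemma IsSolution.weighted_abs_le (hx : IsSolution a h s ψ x)
    (hb : CoefficientBounds a h τ N R α Amax r s) {ν c T : ℝ} (hν : 0 ≤ ν) (hνα : ν < α)
    (hc : 0 ≤ c)
    (hP : ∀ᵐ t, s ≤ t → t ≤ T → Real.exp (ν * (t - s)) * |deriv x t| ≤ c)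
    {t : ℝ} (hst : s + r ≤ t) (htT : t ≤ T) :
    Real.exp (ν * (t - s)) * |x t| ≤ max (Real.exp (ν * r) * |x (s + r)|)
      (α / (α - ν) * ((∑ j, τ j * R j) * (Real.exp (ν * r) * c))) := by
  set G := (∑ j, τ j * R j) * (Real.exp (ν * r) * c) with hG
  have hG0 : 0 ≤ G := mul_nonneg
    (Finset.sum_nonneg fun j _ => mul_nonneg (hb.τ_nonneg j) (hb.R_nonneg j)) (by positivity)
  set m := max (Real.exp (ν * r) * |x (s + r)|) (α / (α - ν) * G) with hm
  have hsr : s ≤ s + r := by linarith [hb.r_nonneg]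
  -- Both signs of `x` are treated at once.
  have main : ∀ ε : ℝ, |ε| = 1 → Real.exp (ν * (t - s)) * (ε * x t) ≤ m := by
    intro ε hε
    have hac : AbsolutelyContinuousOnInterval
        (fun u => Real.exp (ν * (u - s)) * (ε * x u)) (s + r) t := by
      refine AbsolutelyContinuousOnInterval.fun_mul ?_ ((hx.absCont_of_le hsr hst).const_mul ε)
      refine ContDiffOn.absolutelyContinuousOnInterval (ContDiff.contDiffOn ?_)
      fun_prop
    refine hac.le_of_ae_deriv_nonpos_above hst ?_ ?_
    · refine le_trans ?_ (le_max_left _ _)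
      rw [add_sub_cancel_left]
      refine mul_le_mul_of_nonneg_left ?_ (Real.exp_pos _).le
      calc ε * x (s + r) ≤ |ε * x (s + r)| := le_abs_self _
        _ = _ := by rw [abs_mul, hε, one_mul]
    · filter_upwards [hx.ae_hasDerivAt, hb.sum_mem, hx.ae_weighted_perturbation_le hb hν hc hP]
        with u hd hA hpert hsu hut hu
      have hsu' : s ≤ u := hsr.trans hsu
      obtain ⟨hA1, -⟩ := hA hsu'
      have hdx : HasDerivAt x (deriv x u) u := (hd hsu').differentiableAt.hasDerivAt
      have h1 : HasDerivAt (fun u : ℝ => ν * (u - s)) (ν * 1) u :=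
        ((hasDerivAt_id u).sub_const s).const_mul ν
      rw [(h1.exp.fun_mul (hdx.const_mul ε)).deriv]
      have hg := (hpert hsu (hut.trans htT)).2
      set w := Real.exp (ν * (u - s)) with hw
      set A := coeffSum a u with hAdef
      have h2 : w * (ε * (deriv x u + A * x u)) ≤ A * G := by
        refine le_trans (mul_le_mul_of_nonneg_left ?_ (Real.exp_pos _).le) hg
        calc _ ≤ |ε * (deriv x u + A * x u)| := le_abs_self _
          _ = _ := by rw [abs_mul, hε, one_mul]
      have h3 : α / (α - ν) * G ≤ w * (ε * x u) := (le_max_right _ _).trans hu.le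
      have h4 : A * G ≤ (A - ν) * (α / (α - ν) * G) := by
        have : 0 < α - ν := sub_pos.2 hνα
        rw [← mul_assoc (A - ν), mul_div_assoc']
        refine mul_le_mul_of_nonneg_right ?_ hG0
        rw [le_div_iff₀ this]
        nlinarith
      have h5 : (A - ν) * (α / (α - ν) * G) ≤ (A - ν) * (w * (ε * x u)) :=
        mul_le_mul_of_nonneg_left h3 (by linarith)
      nlinarith
  rcases abs_cases (x t) with ⟨h, -⟩ | ⟨h, -⟩
  · rw [h]; simpa using main 1 (by simp)
  · rw [h]; simpa using main (-1) (by simp)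

end Estimates

/-! ### The small gain argument -/

/-- Exponential estimate under a small gain condition. With `X` the maximum of the weighted
solution, `c` a weighted bound on the derivative and `κ = α / (α - ν)`, one has
`X ≤ κ (∑ τ R) exp (ν r) c` up to a multiple of `K`. The first alternative closes this with
`c ≤ (∑ N) exp (ν r) X`, the second one with `c ≤ Amax X + (∑ τ N) exp (ν r) c`. -/
theorem IsSolution.weighted_abs_le_of_small_gain {n : ℕ} {a h : Fin n → ℝ → ℝ}
    {τ N R : Fin n → ℝ} {α Amax r s : ℝ} {ψ : Iic s → ℝ} {x : ℝ → ℝ}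
    (hx : IsSolution a h s ψ x)
    (hb : CoefficientBounds a h τ N R α Amax r s) {K : ℝ} (hK : ∀ u ≤ s, |x u| ≤ K)
    {ν : ℝ} (hν : 0 ≤ ν) (hνα : ν < α)
    (hgain : α / (α - ν) * Real.exp (ν * r) ^ 2 * (∑ j, τ j * R j) * (∑ j, N j) < 1 ∨
      (Real.exp (ν * r) * (∑ j, τ j * N j) < 1 ∧
        α / (α - ν) * Real.exp (ν * r) * (∑ j, τ j * R j) * Amax
          < 1 - Real.exp (ν * r) * (∑ j, τ j * N j)))
    {T : ℝ} (hsT : s ≤ T) :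
    Real.exp (ν * (T - s)) * |x T| ≤
      Real.exp (ν * r) * (2 * Real.exp (2 * (∑ j, N j) * r)) *
        (1 + α / (α - ν) * Real.exp (ν * r) * (∑ j, τ j * R j) * (∑ j, N j)) * K := by
  set E := Real.exp (ν * r) with hE
  set l := ∑ j, N j with hl
  set SR := ∑ j, τ j * R j with hSR
  set SN := ∑ j, τ j * N j with hSN
  set κ := α / (α - ν) with hκ
  set C := 2 * Real.exp (2 * l * r) with hC
  have hr := hb.r_nonneg
  have hl0 : 0 ≤ l := Finset.sum_nonneg fun j _ => hb.N_nonneg j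
  have hSR0 : 0 ≤ SR := Finset.sum_nonneg fun j _ => mul_nonneg (hb.τ_nonneg j) (hb.R_nonneg j)
  have hκ0 : 0 ≤ κ := div_nonneg (hν.trans hνα.le) (sub_nonneg.2 hνα.le)
  have hK0 : 0 ≤ K := (abs_nonneg _).trans (hK s le_rfl)
  have hE1 : 1 ≤ E := Real.one_le_exp (mul_nonneg hν hr)
  have hE0 : 0 < E := Real.exp_pos _
  have hC1 : 1 ≤ C := by
    have : 1 ≤ Real.exp (2 * l * r) := Real.one_le_exp (by positivity)
    linarith
  have hC0 : 0 ≤ C := zero_le_one.trans hC1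
  have hsr : s ≤ s + r := by linarith
  have hEC : 1 ≤ E * C := one_le_mul_of_one_le_of_one_le hE1 hC1
  have hKC : K ≤ C * K := le_mul_of_one_le_left hK0 hC1
  have hKEC : K ≤ E * C * K := le_mul_of_one_le_left hK0 hEC
  have hinit : ∀ v ≤ s + r, |x v| ≤ C * K := by
    intro v hv
    rcases le_total v s with hvs | hsv
    · exact (hK v hvs).trans hKC
    · calc |x v| ≤ 2 * K * Real.exp (2 * l * (v - s)) := hx.abs_le_exp hb hK hsv
        _ ≤ 2 * K * Real.exp (2 * l * r) := by
          gcongr; linarith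
        _ = C * K := by ring
  set w : ℝ → ℝ := fun u => Real.exp (ν * (u - s)) with hw
  have hw0 : ∀ u, 0 < w u := fun u => Real.exp_pos _
  have hwc : Continuous w := by fun_prop
  have hwE : ∀ u v, u - r ≤ v → w u ≤ E * w v := by
    intro u v huv
    simp only [hw, hE, ← Real.exp_add]
    refine Real.exp_le_exp.2 ?_
    nlinarith
  have hws : w s = 1 := by simp [hw]
  obtain ⟨p, ⟨hsp, hpT⟩, hmax⟩ := isCompact_Icc.exists_isMaxOn (nonempty_Icc.2 hsT)
    (hwc.continuousOn.mul ((hx.continuousOn_Icc T).abs))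
  set X := max K (w p * |x p|) with hX
  have hX0 : 0 ≤ X := hK0.trans (le_max_left _ _)
  have hXle : ∀ v, s ≤ v → v ≤ T → w v * |x v| ≤ X := fun v h1 h2 =>
    (hmax ⟨h1, h2⟩).trans (le_max_right _ _)
  have hderiv : ∀ᵐ t, s ≤ t → t ≤ T → w t * |deriv x t| ≤ l * (E * X) := by
    filter_upwards [hx.ae_abs_deriv_le hb] with t ht hst htT
    have h1 : |deriv x t| ≤ l * (E * X / w t) := by
      refine ht hst _ fun v hrv hvt => ?_
      rw [le_div_iff₀ (hw0 t)]
      rcases le_total v s with hvs | hsv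
      · calc |x v| * w t ≤ K * (E * w s) := by
              have := hwE t s (hrv.trans hvs)
              have := hK v hvs
              have := (hw0 t).le
              gcongr
          _ = E * K := by rw [hws]; ring
          _ ≤ E * X := by gcongr; exact le_max_left _ _
      · calc |x v| * w t ≤ |x v| * (E * w v) := by gcongr; exact hwE t v hrv
          _ = E * (w v * |x v|) := by ring
          _ ≤ E * X := by gcongr; exact hXle v hsv (hvt.trans htT)
    calc w t * |deriv x t| ≤ w t * (l * (E * X / w t)) := by
          have := (hw0 t).le
          gcongr
      _ = l * (E * X) := by have := (hw0 t).ne'; field_simp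
  have hXc : ∀ c, 0 ≤ c → (∀ᵐ t, s ≤ t → t ≤ T → w t * |deriv x t| ≤ c) →
      X ≤ max (E * C * K) (κ * (SR * (E * c))) := by
    intro c hc hP
    refine max_le (hKEC.trans (le_max_left _ _)) ?_
    rcases le_total p (s + r) with hp | hp
    · refine le_trans ?_ (le_max_left _ _)
      calc w p * |x p| ≤ (E * w s) * (C * K) := by
            have := hwE p s (by linarith)
            have := hinit p hp
            have := (hw0 s).le
            gcongr
        _ = _ := by rw [hws]; ring
    · refine (hx.weighted_abs_le hb hν hνα hc hP hp hpT).trans (max_le_max_right _ ?_)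
      rw [mul_assoc]
      exact mul_le_mul_of_nonneg_left (hinit _ le_rfl) hE0.le
  have hfinal : X ≤ E * C * (1 + κ * E * SR * l) * K := by
    have hsplit : E * C * (1 + κ * E * SR * l) * K
        = E * C * K + κ * (SR * (E * (l * (E * (C * K))))) := by ring
    have hpos : 0 ≤ κ * (SR * (E * (l * (E * (C * K))))) := by positivity
    have hECK0 : 0 ≤ E * C * K := by positivity
    -- Absorption: a gain below one makes the feedback term irrelevant.
    have habs : ∀ q, q < 1 → X ≤ q * X → X ≤ E * C * K := fun q hq hle => by nlinarith
    rw [hsplit]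
    rcases hgain with hg | ⟨hg1, hg2⟩
    · rcases le_max_iff.1 (hXc _ (by positivity) hderiv) with h1 | h1
      · linarith
      · have := habs (κ * E ^ 2 * SR * l) hg (h1.trans_eq (by ring))
        linarith
    · -- The derivative bound `c` is taken least possible, so that it obeys its own estimate.
      have hiff : ∀ c, (∀ᵐ t ∂(volume.restrict (Icc s T)), |w t * deriv x t| ≤ c) ↔
          ∀ᵐ t, s ≤ t → t ≤ T → w t * |deriv x t| ≤ c := by
        intro c
        rw [ae_restrict_iff' measurableSet_Icc]
        refine Filter.eventually_congr (Filter.Eventually.of_forall fun t => ?_)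
        rw [abs_mul, abs_of_pos (hw0 t), mem_Icc, and_imp]
      obtain ⟨c, hc, hP, hcle⟩ := exists_ae_bound_le_of_improvement
        (μ := volume.restrict (Icc s T)) (f := fun t => w t * deriv x t)
        (p := l * (E * (C * K))) (q := Amax * X) (σ := E * SN) (by positivity)
        ((hiff _).2 hderiv) (by
          intro c hc hP
          rw [hiff] at hP ⊢
          filter_upwards [hx.ae_abs_deriv_le hb, hx.ae_weighted_perturbation_le hb hν hc hP,
            hb.sum_mem] with t h1 h2 h3 hst htT
          rcases le_total t (s + r) with htr | htr
          · refine le_trans ?_ (le_max_left _ _)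
            have h6 := h1 hst (C * K) fun v _ hvt => hinit v (hvt.trans htr)
            calc w t * |deriv x t| ≤ (E * w s) * (l * (C * K)) := by
                  have := hwE t s (by linarith)
                  have := (hw0 s).le
                  gcongr
              _ = _ := by rw [hws]; ring
          · refine le_trans ?_ (le_max_right _ _)
            have hA0 : 0 ≤ coeffSum a t := (hν.trans hνα.le).trans (h3 hst).1
            have h6 : |deriv x t| ≤ |deriv x t + coeffSum a t * x t| + coeffSum a t * |x t| := by
              have := abs_sub (deriv x t + coeffSum a t * x t) (coeffSum a t * x t)
              rwa [add_sub_cancel_right, abs_mul (coeffSum a t), abs_of_nonneg hA0] at this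
            calc w t * |deriv x t|
                ≤ w t * (|deriv x t + coeffSum a t * x t| + coeffSum a t * |x t|) :=
                  mul_le_mul_of_nonneg_left h6 (hw0 t).le
              _ = w t * |deriv x t + coeffSum a t * x t| + coeffSum a t * (w t * |x t|) := by ring
              _ ≤ SN * (E * c) + Amax * X :=
                  add_le_add (h2 htr htT).1 (mul_le_mul (h3 hst).2 (hXle t hst htT)
                    (mul_nonneg (hw0 t).le (abs_nonneg _)) (hA0.trans (h3 hst).2))
              _ = _ := by ring)
      rw [hiff] at hP
      rcases le_max_iff.1 (hXc c hc hP) with h1 | h1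
      · linarith
      rcases le_max_iff.1 hcle with h2 | h2
      · have : κ * (SR * (E * c)) ≤ κ * (SR * (E * (l * (E * (C * K))))) := by gcongr
        linarith
      · have hpos1 : 0 < 1 - E * SN := by linarith
        have h3 : c ≤ Amax * X / (1 - E * SN) := by
          rw [le_div_iff₀ hpos1]; linarith
        have h4 : X ≤ κ * (SR * (E * (Amax * X / (1 - E * SN)))) := h1.trans (by gcongr)
        have := habs (κ * E * SR * Amax / (1 - E * SN)) ((div_lt_one hpos1).2 hg2)
          (h4.trans_eq (by ring))
        linarith
  exact (hXle T hsT le_rfl).trans hfinal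

/-- The strict inequalities hold at `ν = 0`, so by continuity the small gain condition holds for
some positive rate `ν`. -/
lemma exists_small_gain_rate {α r l SR SN Amax : ℝ} (hα : 0 < α)
    (h : SR * l < 1 ∨ (SN < 1 ∧ SR * Amax < 1 - SN)) :
    ∃ ν, 0 < ν ∧ ν < α ∧ (α / (α - ν) * Real.exp (ν * r) ^ 2 * SR * l < 1 ∨
      (Real.exp (ν * r) * SN < 1 ∧
        α / (α - ν) * Real.exp (ν * r) * SR * Amax < 1 - Real.exp (ν * r) * SN)) := by
  have hκ : ContinuousAt (fun ν : ℝ => α / (α - ν)) 0 :=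
    continuousAt_const.div (by fun_prop) (by simpa using hα.ne')
  have hE : ContinuousAt (fun ν : ℝ => Real.exp (ν * r)) 0 := by fun_prop
  have hsmall : ∀ᶠ ν in nhds (0 : ℝ), ν < α := eventually_lt_nhds hα
  have hev : ∀ᶠ ν in nhds (0 : ℝ), (α / (α - ν) * Real.exp (ν * r) ^ 2 * SR * l < 1 ∨
      (Real.exp (ν * r) * SN < 1 ∧
        α / (α - ν) * Real.exp (ν * r) * SR * Amax < 1 - Real.exp (ν * r) * SN)) := by
    rcases h with h | ⟨h1, h2⟩
    · have hc : ContinuousAt (fun ν : ℝ => α / (α - ν) * Real.exp (ν * r) ^ 2 * SR * l) 0 :=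
        ((hκ.mul (hE.pow 2)).mul continuousAt_const).mul continuousAt_const
      have := hc.eventually_lt (continuousAt_const (y := (1 : ℝ))) (by simpa [hα.ne'] using h)
      exact this.mono fun ν => Or.inl
    · have hc1 : ContinuousAt (fun ν : ℝ => Real.exp (ν * r) * SN) 0 := hE.mul continuousAt_const
      have hc2 : ContinuousAt (fun ν : ℝ => α / (α - ν) * Real.exp (ν * r) * SR * Amax) 0 :=
        ((hκ.mul hE).mul continuousAt_const).mul continuousAt_const
      have e1 := hc1.eventually_lt (continuousAt_const (y := (1 : ℝ))) (by simpa using h1)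
      have e2 := hc2.eventually_lt (continuousAt_const.sub hc1 (f := fun _ => (1 : ℝ)))
        (by simpa [hα.ne'] using h2)
      filter_upwards [e1, e2] with ν h3 h4 using Or.inr ⟨h3, h4⟩
  obtain ⟨ν, ⟨h1, h2⟩, h3⟩ :=
    (((hsmall.and hev).filter_mono nhdsWithin_le_nhds).and
      (self_mem_nhdsWithin : Ioi (0 : ℝ) ∈ nhdsWithin 0 (Ioi 0))).exists
  exact ⟨ν, h3, h1, h2⟩

/-! ### Stability -/

lemma memLp_top_coeffSum {n : ℕ} {t₀ : ℝ} {a : Fin n → ℝ → ℝ}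
    (ha : ∀ j, MemLp (a j) ∞ (halfLine t₀)) : MemLp (coeffSum a) ∞ (halfLine t₀) :=
  memLp_finsetSum Finset.univ fun j _ => ha j

lemma memLp_top_div_coeffSum {n : ℕ} {t₀ α : ℝ} {a : Fin n → ℝ → ℝ}
    (ha : ∀ j, MemLp (a j) ∞ (halfLine t₀)) (hα : 0 < α)
    (hA : ∀ᵐ t ∂(halfLine t₀), α ≤ coeffSum a t) (j : Fin n) :
    MemLp (fun t => a j t / coeffSum a t) ∞ (halfLine t₀) := by
  refine (ha j).of_le_mul (c := α⁻¹) ?_ ?_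
  · exact ((ha j).aestronglyMeasurable.aemeasurable.div
      (memLp_top_coeffSum ha).aestronglyMeasurable.aemeasurable).aestronglyMeasurable
  · filter_upwards [hA] with t ht
    rw [norm_div, div_eq_inv_mul]
    gcongr
    exact ht.trans (le_abs_self _)

lemma ae_of_ae_halfLine {t₀ s : ℝ} (hs : t₀ ≤ s) {P : ℝ → Prop}
    (hP : ∀ᵐ t ∂(halfLine t₀), P t) : ∀ᵐ t, s ≤ t → P t := by
  filter_upwards [(ae_restrict_iff' measurableSet_Ici).1 hP] with t ht hst
  exact ht (hs.trans hst)

lemma coefficientBounds_of_essNorm {n : ℕ} {t₀ α s : ℝ} {a h : Fin n → ℝ → ℝ} {τ : Fin n → ℝ}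
    (ha : ∀ j, MemLp (a j) ∞ (halfLine t₀))
    (hdelay : ∀ j, ∀ᵐ t ∂(halfLine t₀), 0 ≤ t - h j t ∧ t - h j t ≤ τ j)
    (hα : 0 < α) (hA : ∀ᵐ t ∂(halfLine t₀), α ≤ coeffSum a t) (hs : t₀ ≤ s) :
    CoefficientBounds a h τ (fun j => essNorm t₀ (a j))
      (fun j => essNorm t₀ (fun t => a j t / coeffSum a t)) α (essNorm t₀ (coeffSum a))
      (∑ j, τ j) s := by
  have hτ : ∀ j, 0 ≤ τ j := fun j => by
    have : (ae (halfLine t₀)).NeBot := by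
      rw [ae_neBot, halfLine, Ne, Measure.restrict_eq_zero]
      simp
    obtain ⟨t, h1, h2⟩ := (hdelay j).exists
    exact h1.trans h2
  refine ⟨Finset.sum_nonneg fun j _ => hτ j, hτ,
    fun j => Finset.single_le_sum (fun i _ => hτ i) (Finset.mem_univ j),
    fun j => ENNReal.toReal_nonneg, fun j => ENNReal.toReal_nonneg, ae_of_ae_halfLine hs ?_,
    ae_of_ae_halfLine hs ?_, ae_of_ae_halfLine hs ?_, ae_of_ae_halfLine hs ?_⟩
  · filter_upwards [ae_all_iff.2 hdelay] with t ht j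
    exact ⟨by linarith [(ht j).2], by linarith [(ht j).1]⟩
  · exact ae_all_iff.2 fun j => (ha j).ae_abs_le_essNorm
  · refine ae_all_iff.2 fun j => ?_
    filter_upwards [(memLp_top_div_coeffSum ha hα hA j).ae_abs_le_essNorm, hA] with t ht hAt
    have hpos : 0 < coeffSum a t := hα.trans_le hAt
    rwa [abs_div, abs_of_pos hpos, div_le_iff₀ hpos] at ht
  · filter_upwards [(memLp_top_coeffSum ha).ae_abs_le_essNorm, hA] with t ht hAt
    exact ⟨hAt, (le_abs_self _).trans ht⟩

theorem corollary4p2 {n : ℕ} (t₀ : ℝ) (a h : Fin n → ℝ → ℝ) (τ : Fin n → ℝ) (α : ℝ)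
    (ha : ∀ j, MemLp (a j) ∞ (halfLine t₀))
    (hh : ∀ j, AEMeasurable (h j) (halfLine t₀))
    (hdelay : ∀ j, ∀ᵐ t ∂(halfLine t₀), 0 ≤ t - h j t ∧ t - h j t ≤ τ j)
    (hα : 0 < α)
    (hA : ∀ᵐ t ∂(halfLine t₀), α ≤ coeffSum a t)
    (hcond :
      ((∑ j, τ j * essNorm t₀ (a j) < 1) ∧
        (∑ j, essNorm t₀ (a j)) *
          (∑ j, τ j * essNorm t₀ (fun t => a j t / coeffSum a t)) < 1) ∨
      (essNorm t₀ (coeffSum a) *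
          (∑ j, τ j * essNorm t₀ (fun t => a j t / coeffSum a t)) <
        1 - ∑ j, τ j * essNorm t₀ (a j))) :
    UniformlyExponentiallyStable t₀ a h := by
  have hb := fun s (hs : t₀ ≤ s) => coefficientBounds_of_essNorm ha hdelay hα hA hs
  have hb₀ := hb t₀ le_rfl
  have hSR0 : 0 ≤ ∑ j, τ j * essNorm t₀ (fun t => a j t / coeffSum a t) :=
    Finset.sum_nonneg fun j _ => mul_nonneg (hb₀.τ_nonneg j) (hb₀.R_nonneg j)
  have hl0 : 0 ≤ ∑ j, essNorm t₀ (a j) := Finset.sum_nonneg fun j _ => hb₀.N_nonneg j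
  have hAmax0 : 0 ≤ essNorm t₀ (coeffSum a) := ENNReal.toReal_nonneg
  obtain ⟨ν, hν, hνα, hgain⟩ := exists_small_gain_rate (r := ∑ j, τ j)
    (l := ∑ j, essNorm t₀ (a j))
    (SR := ∑ j, τ j * essNorm t₀ (fun t => a j t / coeffSum a t))
    (SN := ∑ j, τ j * essNorm t₀ (a j)) (Amax := essNorm t₀ (coeffSum a)) hα <| by
      rcases hcond with ⟨-, h2⟩ | h2
      · exact Or.inl (by rwa [mul_comm])
      · refine Or.inr ⟨?_, by rwa [mul_comm]⟩
        have := mul_nonneg hAmax0 hSR0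
        linarith
  have hκ : 0 ≤ α / (α - ν) := div_nonneg hα.le (sub_nonneg.2 hνα.le)
  refine ⟨Real.exp (ν * ∑ j, τ j) *
    (2 * Real.exp (2 * (∑ j, essNorm t₀ (a j)) * ∑ j, τ j)) *
      (1 + α / (α - ν) * Real.exp (ν * ∑ j, τ j) *
        (∑ j, τ j * essNorm t₀ (fun t => a j t / coeffSum a t)) * ∑ j, essNorm t₀ (a j)),
    ν, mul_pos (mul_pos (Real.exp_pos _) (mul_pos two_pos (Real.exp_pos _)))
      (add_pos_of_pos_of_nonneg one_pos
        (mul_nonneg (mul_nonneg (mul_nonneg hκ (Real.exp_pos _).le) hSR0) hl0)),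
    hν, fun s hs ψ _ hψ x hx t hst => ?_⟩
  have hK : ∀ u ≤ s, |x u| ≤ ⨆ u : Iic s, |ψ u| := fun u hu => by
    rw [hx.initial ⟨u, hu⟩]
    exact le_ciSup hψ (⟨u, hu⟩ : Iic s)
  have := hx.weighted_abs_le_of_small_gain (hb s hs) hK hν.le hνα hgain hst
  rw [mul_comm (Real.exp (ν * (t - s))), ← le_div_iff₀ (Real.exp_pos _)] at this
  rw [neg_mul, Real.exp_neg, mul_right_comm, ← div_eq_mul_inv]
  exact this
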